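/- **Conventions.** Let $H$ be a locally compact Hausdorff topological group; base spaces are arbitrary topological spaces. A *partial action* of $H$ on a set $X$ consists of subsets $X_t\subset X$ and bijections $\alpha_t:X_{t^{-1}}\to X_t$ ($t\in H$) such that $X_e=X$, $\alpha_e=\mathrm{id}_X$, and whenever $x\in X_{t^{-1}}$ and $\alpha_t(x)\in X_{s^{-1}}$, then $x\in X_{(st)^{-1}}$ and $\alpha_{st}(x)=\alpha_s(\alpha_t(x))$. For $X$ a topological space, it is *continuous* if $\Gamma_\alpha=\{(t,x): x\in X_{t^{-1}}\}$ is open in $H\times X$ and $\Gamma_\alpha\to X$, $(t,x)\mapsto\alpha_t(x)$, is continuous; it is *global* (an action) if $X_t=X$ for all $t$. A morphism from $\alpha$ (on $X$) to $\beta$ (on $Y$) is a continuous $f:X\to Y$ with $f(X_t)\subset Y_t$ and $\beta_t\circ f=f\circ\alpha_t$ on $X_{t^{-1}}$ for all $t$. The orbit of $U\subset X$ is $\bigcup_t\alpha_t(U\cap X_{t^{-1}})$. An *upper semicontinuous $C^*$-bundle* $\mathbf B=\{B_x\}_{x\in X}$ is a family of $C^*$-algebras together with a topology on the disjoint union $B$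 of the $B_x$ such that the projection $p:B\to X$ is continuous and open; $b\mapsto\|b\|$ is upper semicontinuous on $B$; addition and multiplication are continuous on $\{(a,b)\in B\times B: p(a)=p(b)\}$; the involution and, for each $\lambda\in\mathbb C$, the map $b\mapsto\lambda b$ are continuous; and every net $(b_i)$ in $B$ with $p(b_i)\to x$ and $\|b_i\|\to0$ converges to $0_x$. It is a *continuous $C^*$-bundle* if $b\mapsto\|b\|$ is continuous. A *continuous partial action* of $H$ on $\mathbf B$ is a pair $\alpha$ of continuous partial actions of $H$ on $B$ and on $X$ such that $p$ is a morphism, $p^{-1}(X_t)$ is the range of $\alpha_t$ on $B$, and each $\alpha_t$ restricts to a $*$-homomorphism on each fibre over $X_{t^{-1}}$; it is *global* (an action) if the partial action on $B$ is. If $\beta$ is a partial action of $H$ on $\mathbf C$, with projection $q:C\to Y$, a *morphism* $\alpha\to\beta$ is a pair of morphisms of partial actions $f:X\to Y$ and $F:B\to C$ with $q\circ F=f\circ p$ and $F$ a $*$-homomorphism on each fibre. Morphisms are composed coordinatewise, and an isomorphism is a morphism with a two-sided inverse morphism. For an action $\beta$ of $H$ on $\mathbf C$ and an open set $U\subset Y$,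 the *restriction* $\beta_U$ is the partial action, on the restricted bundle $\{C_y\}_{y\in U}$ (with total space $q^{-1}(U)\subset C$), given by the maps $U\cap\beta_{t^{-1}}(U)\to U\cap\beta_t(U)$ and $q^{-1}(U)\cap\beta_{t^{-1}}(q^{-1}(U))\to q^{-1}(U)\cap\beta_t(q^{-1}(U))$ induced by $\beta_t$. **Theorem.** For every continuous partial action $\alpha$ of $H$ on an upper semicontinuous $C^*$-bundle $\mathbf B$ over $X$ there exist an action $\alpha^e$ of $H$ on an upper semicontinuous $C^*$-bundle $\mathbf B^e$ over a space $X^e$ and a morphism $\iota=(\iota_X,\iota_B):\alpha\to\alpha^e$ such that for every morphism $\psi:\alpha\to\beta$, where $\beta$ is an action of $H$ on an upper semicontinuous $C^*$-bundle, there is a unique morphism $\psi^e:\alpha^e\to\beta$ with $\psi^e\circ\iota=\psi$. Moreover, $(\iota,\alpha^e)$ is unique up to canonical isomorphism (if $(\kappa,\gamma)$ has the same property, there is a unique isomorphism $\varphi:\alpha^e\to\gamma$ with $\varphi\circ\iota=\kappa$), and 1. $\iota_X(X)$ is open in $X^e$; 2. $\iota$ is an isomorphism from $\alpha$ onto the restriction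 $(\alpha^e)_{\iota_X(X)}$; 3. $X^e$ is the orbit of $\iota_X(X)$ under $\alpha^e$; 4. $\mathbf B^e$ is a continuous $C^*$-bundle if and only if $\mathbf B$ is. -/

import Mathlib

open Set Filter Topology Bundle

universe h x b v w

noncomputable section

/-! ### Partial actions on topological spaces -/

/-- A partial action of a group `H` on `X`: sets `dom t = X_t` and bijections
`act t : X_{t⁻¹} → X_t`. The map `act t` is written as a function on all of `X`; its values
outside `X_{t⁻¹}` carry no meaning and are never used. -/
structure PartialAction (H : Type*) [Group H] (X : Type*) where
  dom : H → Set X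
  act : H → X → X
  dom_one : dom 1 = univ
  bijOn : ∀ t, BijOn (act t) (dom t⁻¹) (dom t)
  act_one : ∀ x, act 1 x = x
  mul_mem : ∀ s t x, x ∈ dom t⁻¹ → act t x ∈ dom s⁻¹ → x ∈ dom (s * t)⁻¹
  act_mul : ∀ s t x, x ∈ dom t⁻¹ → act t x ∈ dom s⁻¹ → act (s * t) x = act s (act t x)

namespace PartialAction

variable {H : Type*} [Group H] {X Y Z : Type*}

/-- The domain `Γ = {(t, x) | x ∈ X_{t⁻¹}}`. -/
def graphDom (α : PartialAction H X) : Set (H × X) := {q | q.2 ∈ α.dom q.1⁻¹}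

/-- The domain is open and the action map is continuous on it. -/
structure IsContinuous [TopologicalSpace H] [TopologicalSpace X] (α : PartialAction H X) :
    Prop where
  isOpen_graphDom : IsOpen α.graphDom
  continuousOn : ContinuousOn (fun q : H × X => α.act q.1 q.2) α.graphDom

/-- The partial action is a (global) action: every `X_t` is the whole space. -/
def IsGlobal (α : PartialAction H X) : Prop := ∀ t, α.dom t = univ

/-- Morphisms of (continuous) partial actions. -/
structure IsMorphism [TopologicalSpace X] [TopologicalSpace Y] (α : PartialAction H X)
    (β : PartialAction H Y) (f : X → Y) : Prop where
  continuous : Continuous f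
  mapsTo : ∀ t, MapsTo f (α.dom t) (β.dom t)
  map_act : ∀ t, ∀ x ∈ α.dom t⁻¹, β.act t (f x) = f (α.act t x)

/-- The orbit of a subset. -/
def orbit (α : PartialAction H X) (U : Set X) : Set X := ⋃ t, α.act t '' (U ∩ α.dom t⁻¹)

theorem IsGlobal.act_mul {β : PartialAction H Y} (hβ : β.IsGlobal) (s t : H) (y : Y) :
    β.act (s * t) y = β.act s (β.act t y) :=
  β.act_mul s t y (by simp [hβ t⁻¹]) (by simp [hβ s⁻¹])

theorem IsGlobal.act_inv_act {β : PartialAction H Y} (hβ : β.IsGlobal) (t : H) (y : Y) :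
    β.act t⁻¹ (β.act t y) = y := by
  rw [← hβ.act_mul, inv_mul_cancel, β.act_one]

theorem IsGlobal.act_act_inv {β : PartialAction H Y} (hβ : β.IsGlobal) (t : H) (y : Y) :
    β.act t (β.act t⁻¹ y) = y := by
  rw [← hβ.act_mul, mul_inv_cancel, β.act_one]

open Classical in
/-- The map `Z ∩ β_{t⁻¹}(Z) → Z ∩ β_t(Z)` induced by `β_t`, where `Z` is seen as a subset of `Y`
through the injection `j`; outside of its domain it is given the value `z`. -/
def restrictAct (β : PartialAction H Y) (j : Z → Y) (t : H) (z : Z) : Z :=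
  if h : ∃ w, j w = β.act t (j z) then h.choose else z

theorem restrictAct_spec (β : PartialAction H Y) (j : Z → Y) {t : H} {z : Z}
    (h : ∃ w, j w = β.act t (j z)) : j (β.restrictAct j t z) = β.act t (j z) := by
  rw [restrictAct, dif_pos h]; exact h.choose_spec

theorem exists_of_inv {β : PartialAction H Y} (hβ : β.IsGlobal) (j : Z → Y) {t : H} {z : Z}
    (h : ∃ w, β.act t⁻¹ (j w) = j z) : ∃ w, j w = β.act t (j z) := by
  obtain ⟨w, hw⟩ := h
  exact ⟨w, by rw [← hw, hβ.act_act_inv]⟩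

/-- The restriction of a global action `β` on `Y` to a subset `Z` of `Y`, the subset being given
by an injection `j : Z → Y`: here `Z_t = Z ∩ β_t(Z)`, and `t` acts as `β_t`. -/
def restrict (β : PartialAction H Y) (hβ : β.IsGlobal) (j : Z → Y)
    (hj : Function.Injective j) : PartialAction H Z where
  dom t := {z | ∃ w, β.act t (j w) = j z}
  act := β.restrictAct j
  dom_one := by
    ext z; exact ⟨fun _ => trivial, fun _ => ⟨z, β.act_one _⟩⟩
  bijOn t := by
    refine ⟨?_, ?_, ?_⟩
    · intro z hz
      exact ⟨z, (β.restrictAct_spec j (exists_of_inv hβ j hz)).symm⟩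
    · intro z hz z' hz' h
      have h1 := β.restrictAct_spec j (exists_of_inv hβ j hz)
      have h2 := β.restrictAct_spec j (exists_of_inv hβ j hz')
      apply hj
      rw [← hβ.act_inv_act t (j z), ← hβ.act_inv_act t (j z'), ← h1, ← h2, h]
    · rintro z ⟨w, hw⟩
      refine ⟨w, ⟨z, by rw [← hw, hβ.act_inv_act]⟩, ?_⟩
      apply hj
      rw [β.restrictAct_spec j ⟨z, hw.symm⟩, hw]
  act_one z := by
    apply hj
    rw [β.restrictAct_spec j ⟨z, (β.act_one _).symm⟩, β.act_one]
  mul_mem s t z hz hz' := by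
    have h1 := β.restrictAct_spec j (exists_of_inv hβ j hz)
    have h2 := β.restrictAct_spec j (exists_of_inv hβ j hz')
    refine ⟨β.restrictAct j s (β.restrictAct j t z), ?_⟩
    rw [h2, h1, ← hβ.act_mul s t, hβ.act_inv_act]
  act_mul s t z hz hz' := by
    have h1 := β.restrictAct_spec j (exists_of_inv hβ j hz)
    have h2 := β.restrictAct_spec j (exists_of_inv hβ j hz')
    apply hj
    rw [h2, h1, ← hβ.act_mul]
    refine β.restrictAct_spec j ⟨β.restrictAct j s (β.restrictAct j t z), ?_⟩
    rw [h2, h1, ← hβ.act_mul]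

theorem map_restrict_act (β : PartialAction H Y) (hβ : β.IsGlobal) (j : Z → Y)
    (hj : Function.Injective j) {t : H} {z : Z} (hz : z ∈ (β.restrict hβ j hj).dom t⁻¹) :
    j ((β.restrict hβ j hj).act t z) = β.act t (j z) :=
  β.restrictAct_spec j (exists_of_inv hβ j hz)

theorem mem_restrict_dom_inv (β : PartialAction H Y) (hβ : β.IsGlobal) (j : Z → Y)
    (hj : Function.Injective j) {t : H} {z : Z} :
    z ∈ (β.restrict hβ j hj).dom t⁻¹ ↔ β.act t (j z) ∈ range j := by
  refine ⟨fun h => exists_of_inv hβ j h, ?_⟩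
  rintro ⟨w, hw⟩
  exact ⟨w, by rw [hw, hβ.act_inv_act]⟩

theorem restrict_isContinuous [TopologicalSpace H] [TopologicalSpace Y] [TopologicalSpace Z]
    (β : PartialAction H Y) (hβ : β.IsGlobal) (hc : β.IsContinuous) (j : Z → Y)
    (hj : IsOpenEmbedding j) : (β.restrict hβ j hj.injective).IsContinuous := by
  have hcont : Continuous fun q : H × Y => β.act q.1 q.2 := by
    have : β.graphDom = univ := by ext q; simp [graphDom, hβ q.1⁻¹]
    have h := hc.continuousOn
    rw [this] at h
    exact continuousOn_univ.mp h
  have hcont' : Continuous fun q : H × Z => β.act q.1 (j q.2) :=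
    hcont.comp (continuous_fst.prodMk (hj.continuous.comp continuous_snd))
  refine ⟨?_, ?_⟩
  · have : (β.restrict hβ j hj.injective).graphDom
        = (fun q : H × Z => β.act q.1 (j q.2)) ⁻¹' range j := by
      ext q
      exact β.mem_restrict_dom_inv hβ j hj.injective
    rw [this]
    exact hj.isOpen_range.preimage hcont'
  · rw [hj.isInducing.continuousOn_iff]
    refine hcont'.continuousOn.congr ?_
    intro q hq
    exact β.map_restrict_act hβ j hj.injective hq

theorem restrict_isMorphism [TopologicalSpace Y] [TopologicalSpace Z]
    (β : PartialAction H Y) (hβ : β.IsGlobal) (j : Z → Y)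
    (hj : Function.Injective j) (hc : Continuous j) :
    (β.restrict hβ j hj).IsMorphism β j :=
  ⟨hc, fun t z _ => by simp [hβ t], fun _ _ hz => (β.map_restrict_act hβ j hj hz).symm⟩

theorem isMorphism_id [TopologicalSpace X] (α : PartialAction H X) : α.IsMorphism α id :=
  ⟨continuous_id, fun _ => mapsTo_id _, fun _ _ _ => rfl⟩

theorem IsMorphism.comp [TopologicalSpace X] [TopologicalSpace Y] [TopologicalSpace Z]
    {α : PartialAction H X} {β : PartialAction H Y} {γ : PartialAction H Z} {g : Y → Z}
    {f : X → Y} (hg : β.IsMorphism γ g) (hf : α.IsMorphism β f) : α.IsMorphism γ (g ∘ f) :=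
  ⟨hg.continuous.comp hf.continuous, fun t => (hg.mapsTo t).comp (hf.mapsTo t),
    fun t x hx => by
      simp only [Function.comp_apply]
      rw [hg.map_act t _ (hf.mapsTo _ hx), hf.map_act t x hx]⟩

end PartialAction

/-! ### Upper semicontinuous C*-bundles -/

/-- An upper semicontinuous C*-bundle over an arbitrary topological space `X`: a family of
(complex, not necessarily unital) C*-algebras `B_x`, with a topology on the disjoint union
`B = ⨆ B_x` such that the projection is continuous and open (it is onto, as every fibre contains
`0`), the norm is upper semicontinuous, the algebraic operations are continuous (addition and
multiplication on `{(a, b) | p a = p b}` with the topology of `B × B`), and every net `b_i` in `B`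
with `p b_i → x` and `‖b_i‖ → 0` converges to `0_x`. -/
structure USCStarBundle (X : Type*) [TopologicalSpace X] where
  fiber : X → Type*
  [algebra : ∀ x, NonUnitalCStarAlgebra (fiber x)]
  [topology : TopologicalSpace (TotalSpace Unit fiber)]
  continuous_proj : Continuous (TotalSpace.proj : TotalSpace Unit fiber → X)
  isOpenMap_proj : IsOpenMap (TotalSpace.proj : TotalSpace Unit fiber → X)
  upperSemicontinuous_norm :
    UpperSemicontinuous fun b : TotalSpace Unit fiber => ‖b.snd‖
  continuous_add : Continuous fun d : TotalSpace (Unit × Unit) (fiber ×ᵇ fiber) =>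
    (⟨d.proj, d.snd.1 + d.snd.2⟩ : TotalSpace Unit fiber)
  continuous_mul : Continuous fun d : TotalSpace (Unit × Unit) (fiber ×ᵇ fiber) =>
    (⟨d.proj, d.snd.1 * d.snd.2⟩ : TotalSpace Unit fiber)
  continuous_smul : ∀ c : ℂ, Continuous fun b : TotalSpace Unit fiber =>
    (⟨b.proj, c • b.snd⟩ : TotalSpace Unit fiber)
  continuous_star : Continuous fun b : TotalSpace Unit fiber =>
    (⟨b.proj, star b.snd⟩ : TotalSpace Unit fiber)
  tendsto_zero : ∀ x, comap (TotalSpace.proj : TotalSpace Unit fiber → X) (𝓝 x) ⊓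
    comap (fun b : TotalSpace Unit fiber => ‖b.snd‖) (𝓝 0) ≤ 𝓝 ⟨x, 0⟩

namespace USCStarBundle

attribute [instance] algebra topology

variable {X : Type*} [TopologicalSpace X]

/-- The total space of the bundle. -/
abbrev Total (B : USCStarBundle X) : Type _ := TotalSpace Unit B.fiber

/-- The projection of the bundle. -/
abbrev proj (B : USCStarBundle X) : B.Total → X := TotalSpace.proj

/-- The bundle is a continuous C*-bundle: the norm is continuous on the total space. -/
def IsContinuous (B : USCStarBundle X) : Prop := Continuous fun b : B.Total => ‖b.snd‖

theorem surjective_proj (B : USCStarBundle X) : Function.Surjective B.proj :=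
  fun x => ⟨⟨x, 0⟩, rfl⟩

/-- The inclusion of the disjoint union of the fibres over `U` into the total space. -/
def incl (B : USCStarBundle X) (U : Set X) :
    TotalSpace Unit (fun u : U => B.fiber u) → B.Total :=
  fun b => ⟨b.proj, b.snd⟩

theorem incl_injective (B : USCStarBundle X) (U : Set X) : Function.Injective (B.incl U) := by
  rintro ⟨⟨x, hx⟩, b⟩ ⟨⟨y, hy⟩, c⟩ h
  simp only [incl, TotalSpace.mk.injEq] at h
  obtain ⟨rfl, h⟩ := h
  obtain rfl := eq_of_heq h
  rfl

theorem range_incl (B : USCStarBundle X) (U : Set X) : range (B.incl U) = B.proj ⁻¹' U := by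
  ext b
  constructor
  · rintro ⟨c, rfl⟩
    exact c.proj.2
  · intro hb
    exact ⟨⟨⟨b.proj, hb⟩, b.snd⟩, rfl⟩

/-- The restriction of a bundle to a subset `U` of the base; its total space is `p⁻¹(U)` with
the relative topology. -/
def restrict (B : USCStarBundle X) (U : Set X) : USCStarBundle U :=
  letI τ : TopologicalSpace (TotalSpace Unit (fun u : U => B.fiber u)) :=
    TopologicalSpace.induced (B.incl U) inferInstance
  have hi : Continuous (B.incl U) := continuous_induced_dom
  have hD : Continuous fun d : TotalSpace (Unit × Unit)
      ((fun u : U => B.fiber u) ×ᵇ (fun u : U => B.fiber u)) =>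
      (⟨d.proj, d.snd⟩ : TotalSpace (Unit × Unit) (B.fiber ×ᵇ B.fiber)) := by
    refine continuous_induced_rng.mpr ?_
    have h : Continuous fun d : TotalSpace (Unit × Unit)
        ((fun u : U => B.fiber u) ×ᵇ (fun u : U => B.fiber u)) =>
        ((⟨d.proj, d.snd.1⟩, ⟨d.proj, d.snd.2⟩) :
          TotalSpace Unit (fun u : U => B.fiber u) × TotalSpace Unit (fun u : U => B.fiber u)) :=
      continuous_induced_dom
    exact (hi.prodMap hi).comp h
  { fiber := fun u => B.fiber u
    continuous_proj := by
      refine continuous_induced_rng.mpr ?_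
      exact B.continuous_proj.comp hi
    isOpenMap_proj := by
      intro V hV
      obtain ⟨W, hW, rfl⟩ := isOpen_induced_iff.mp hV
      refine isOpen_induced_iff.mpr ⟨_, B.isOpenMap_proj W hW, ?_⟩
      ext u
      constructor
      · rintro ⟨b, hb, hbu⟩
        obtain ⟨x, b⟩ := b
        obtain ⟨u, hu⟩ := u
        obtain rfl : x = u := hbu
        exact ⟨⟨⟨x, hu⟩, b⟩, hb, rfl⟩
      · rintro ⟨b, hb, rfl⟩
        exact ⟨_, hb, rfl⟩
    upperSemicontinuous_norm := B.upperSemicontinuous_norm.comp hi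
    continuous_add := continuous_induced_rng.mpr (B.continuous_add.comp hD)
    continuous_mul := continuous_induced_rng.mpr (B.continuous_mul.comp hD)
    continuous_smul := fun c => continuous_induced_rng.mpr ((B.continuous_smul c).comp hi)
    continuous_star := continuous_induced_rng.mpr (B.continuous_star.comp hi)
    tendsto_zero := by
      intro u
      have h := comap_mono (m := B.incl U) (B.tendsto_zero u)
      rw [comap_inf, comap_comap, comap_comap] at h
      rw [nhds_induced, nhds_induced, comap_comap]
      exact h }

/-- The inclusion of the restricted bundle, as a map of total spaces. -/
def restrictIncl (B : USCStarBundle X) (U : Set X) : (B.restrict U).Total → B.Total := B.incl U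

theorem restrictIncl_injective (B : USCStarBundle X) (U : Set X) :
    Function.Injective (B.restrictIncl U) := B.incl_injective U

theorem range_restrictIncl (B : USCStarBundle X) (U : Set X) :
    range (B.restrictIncl U) = B.proj ⁻¹' U := B.range_incl U

theorem isOpenEmbedding_restrictIncl (B : USCStarBundle X) {U : Set X} (hU : IsOpen U) :
    IsOpenEmbedding (B.restrictIncl U) :=
  ⟨⟨⟨rfl⟩, B.restrictIncl_injective U⟩, by
    rw [range_restrictIncl]; exact hU.preimage B.continuous_proj⟩

end USCStarBundle

/-- `F : B → C` maps `B_x` into `C_{f x}` for every `x`, and is a homomorphism of C*-algebras on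
each fibre. -/
def IsFiberwiseHom {X Y : Type*} [TopologicalSpace X] [TopologicalSpace Y] (B : USCStarBundle X)
    (C : USCStarBundle Y) (F : B.Total → C.Total) (f : X → Y) : Prop :=
  ∀ x, ∃ φ : B.fiber x →⋆ₙₐ[ℂ] C.fiber (f x), ∀ b, F ⟨x, b⟩ = ⟨f x, φ b⟩

/-! ### Partial actions on bundles -/

/-- A (continuous) partial action of `H` on an upper semicontinuous C*-bundle: continuous partial
actions on the total space and on the base such that `p⁻¹(X_t) = B_t` (the range of `α_t`), the
projection is a morphism, and every `α_t` is a homomorphism of C*-algebras on each fibre. -/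
structure BundlePartialAction (H : Type*) [Group H] [TopologicalSpace H] {X : Type*}
    [TopologicalSpace X] (B : USCStarBundle X) where
  total : PartialAction H B.Total
  base : PartialAction H X
  total_continuous : total.IsContinuous
  base_continuous : base.IsContinuous
  preimage_dom : ∀ t, B.proj ⁻¹' base.dom t = total.dom t
  proj_isMorphism : total.IsMorphism base B.proj
  fiber_hom : ∀ t, ∀ x ∈ base.dom t⁻¹, ∃ φ : B.fiber x →⋆ₙₐ[ℂ] B.fiber (base.act t x),
    ∀ b, total.act t ⟨x, b⟩ = ⟨base.act t x, φ b⟩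

namespace BundlePartialAction

variable {H : Type*} [Group H] [TopologicalSpace H] {X Y Z : Type*} [TopologicalSpace X]
  [TopologicalSpace Y] [TopologicalSpace Z] {B : USCStarBundle X} {C : USCStarBundle Y}
  {D : USCStarBundle Z}

/-- The partial action on the total space is a global action. -/
def IsGlobal (α : BundlePartialAction H B) : Prop := α.total.IsGlobal

theorem IsGlobal.base {α : BundlePartialAction H B} (h : α.IsGlobal) : α.base.IsGlobal := by
  intro t
  have h1 := α.preimage_dom t
  rw [h t] at h1
  ext x
  have : (⟨x, 0⟩ : B.Total) ∈ B.proj ⁻¹' α.base.dom t := by rw [h1]; trivial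
  simpa using this

/-- A morphism `(F, f)` of partial actions on bundles. -/
@[ext]
structure Morphism (α : BundlePartialAction H B) (β : BundlePartialAction H C) where
  total : B.Total → C.Total
  base : X → Y
  total_isMorphism : α.total.IsMorphism β.total total
  base_isMorphism : α.base.IsMorphism β.base base
  fiberwise : IsFiberwiseHom B C total base

namespace Morphism

/-- The relation `q ∘ F = f ∘ p`. -/
theorem proj_total {α : BundlePartialAction H B} {β : BundlePartialAction H C}
    (φ : Morphism α β) (b : B.Total) : C.proj (φ.total b) = φ.base (B.proj b) := by
  obtain ⟨ψ, hψ⟩ := φ.fiberwise b.proj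
  exact congrArg C.proj (hψ b.snd)

/-- The identity morphism. -/
def id (α : BundlePartialAction H B) : Morphism α α where
  total := _root_.id
  base := _root_.id
  total_isMorphism := α.total.isMorphism_id
  base_isMorphism := α.base.isMorphism_id
  fiberwise x := ⟨NonUnitalStarAlgHom.id ℂ (B.fiber x), fun _ => rfl⟩

/-- Composition of morphisms. -/
def comp {α : BundlePartialAction H B} {β : BundlePartialAction H C}
    {γ : BundlePartialAction H D} (ψ : Morphism β γ) (φ : Morphism α β) : Morphism α γ where
  total := ψ.total ∘ φ.total
  base := ψ.base ∘ φ.base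
  total_isMorphism := ψ.total_isMorphism.comp φ.total_isMorphism
  base_isMorphism := ψ.base_isMorphism.comp φ.base_isMorphism
  fiberwise x := by
    obtain ⟨f, hf⟩ := φ.fiberwise x
    obtain ⟨g, hg⟩ := ψ.fiberwise (φ.base x)
    exact ⟨g.comp f, fun b => by simp [hf, hg]⟩

/-- The morphism has a two-sided inverse. -/
def IsIso {α : BundlePartialAction H B} {β : BundlePartialAction H C} (φ : Morphism α β) : Prop :=
  ∃ ψ : Morphism β α, ψ.comp φ = Morphism.id α ∧ φ.comp ψ = Morphism.id β

end Morphism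

/-- The restriction of a global action to the part of the bundle over an open set `U`. -/
def restrict (β : BundlePartialAction H C) (hβ : β.IsGlobal) (U : Set Y) (hU : IsOpen U) :
    BundlePartialAction H (C.restrict U) where
  total := β.total.restrict hβ (C.restrictIncl U) (C.restrictIncl_injective U)
  base := β.base.restrict hβ.base ((↑) : U → Y) Subtype.val_injective
  total_continuous :=
    β.total.restrict_isContinuous hβ β.total_continuous _ (C.isOpenEmbedding_restrictIncl hU)
  base_continuous :=
    β.base.restrict_isContinuous hβ.base β.base_continuous _ hU.isOpenEmbedding_subtypeVal
  preimage_dom t := by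
    have key : ∀ (t : H) (b : C.Total), C.proj (β.total.act t b) = β.base.act t (C.proj b) :=
      fun t b => (β.proj_isMorphism.map_act t b (by simp [hβ t⁻¹])).symm
    ext b
    constructor
    · rintro ⟨w, hw⟩
      have h1 : β.total.act t⁻¹ (C.restrictIncl U b) ∈ range (C.restrictIncl U) := by
        rw [C.range_restrictIncl, mem_preimage, key]
        have : C.proj (C.restrictIncl U b) = β.base.act t w := hw.symm
        rw [this, hβ.base.act_inv_act]
        exact w.2
      obtain ⟨c, hc⟩ := h1
      exact ⟨c, by rw [hc, PartialAction.IsGlobal.act_act_inv hβ]⟩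
    · rintro ⟨c, hc⟩
      refine ⟨c.proj, ?_⟩
      have := congrArg C.proj hc
      rw [key] at this
      exact this
  proj_isMorphism := by
    have key : ∀ (t : H) (b : C.Total), C.proj (β.total.act t b) = β.base.act t (C.proj b) :=
      fun t b => (β.proj_isMorphism.map_act t b (by simp [hβ t⁻¹])).symm
    have hm : ∀ t, MapsTo (C.restrict U).proj
        ((β.total.restrict hβ (C.restrictIncl U) (C.restrictIncl_injective U)).dom t)
        ((β.base.restrict hβ.base ((↑) : U → Y) Subtype.val_injective).dom t) := by
      rintro t b ⟨c, hc⟩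
      refine ⟨c.proj, ?_⟩
      have := congrArg C.proj hc
      rw [key] at this
      exact this
    refine ⟨(C.restrict U).continuous_proj, hm, ?_⟩
    intro t b hb
    apply Subtype.val_injective
    rw [PartialAction.map_restrict_act _ _ _ _ (hm _ hb)]
    have := congrArg C.proj
      (β.total.map_restrict_act hβ (C.restrictIncl U) (C.restrictIncl_injective U) hb)
    rw [key] at this
    exact this.symm
  fiber_hom t u hu := by
    have h1 := β.base.map_restrict_act hβ.base ((↑) : U → Y) Subtype.val_injective hu
    obtain ⟨φ, hφ⟩ := β.fiber_hom t u (by rw [hβ.base t⁻¹]; trivial)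
    have hdom : ∀ b : (C.restrict U).fiber u, (⟨u, b⟩ : (C.restrict U).Total) ∈
        (β.total.restrict hβ (C.restrictIncl U) (C.restrictIncl_injective U)).dom t⁻¹ := by
      intro b
      refine (β.total.mem_restrict_dom_inv hβ _ (C.restrictIncl_injective U)).mpr ?_
      rw [C.range_restrictIncl]
      change C.proj (β.total.act t ⟨u, b⟩) ∈ U
      rw [hφ b]
      change β.base.act t u ∈ U
      rw [← h1]
      exact Subtype.prop _
    revert φ h1
    generalize β.base.act t u = y
    generalize hv : (β.base.restrict hβ.base ((↑) : U → Y) Subtype.val_injective).act t u = v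
    intro h1 φ hφ
    subst h1
    refine ⟨φ, fun b => C.restrictIncl_injective U ?_⟩
    exact (β.total.map_restrict_act hβ _ (C.restrictIncl_injective U) (hdom b)).trans (hφ b)

/-- The inclusion of the restriction of a global action into that action. -/
def restrictIncl (β : BundlePartialAction H C) (hβ : β.IsGlobal) (U : Set Y) (hU : IsOpen U) :
    Morphism (β.restrict hβ U hU) β where
  total := C.restrictIncl U
  base := (↑)
  total_isMorphism :=
    β.total.restrict_isMorphism hβ _ (C.restrictIncl_injective U) (C.isOpenEmbedding_restrictIncl hU).continuous
  base_isMorphism :=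
    β.base.restrict_isMorphism hβ.base _ Subtype.val_injective continuous_subtype_val
  fiberwise u := ⟨NonUnitalStarAlgHom.id ℂ (C.fiber u), fun _ => rfl⟩

/-- The universal property of a morphism `ι` from a partial action `α` into `γ` (to be a global
action): every morphism from `α` into a global action `β` on an upper semicontinuous C*-bundle
factors uniquely through `ι`. -/
def IsUniversal {α : BundlePartialAction H B} {γ : BundlePartialAction H C}
    (ι : Morphism α γ) : Prop :=
  ∀ (Z : Type v) [TopologicalSpace Z] (D : USCStarBundle.{v, w} Z)
    (β : BundlePartialAction H D), β.IsGlobal →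
    ∀ ψ : Morphism α β, ∃! ψe : Morphism γ β, ψe.comp ι = ψ

end BundlePartialAction

end

/-! The class of `(t, x)` in `H × X` stands for the point `t · x` that an action extending `α` must
contain. Two such expressions `s · x` and `t · y` have to agree exactly when `α` itself takes `x` to
`y` by `t⁻¹ * s`, and the partial action axioms make this an equivalence relation. `H` acts on the
quotient by left multiplication on the first coordinate. An equivariant map out of the quotient is
determined by its values on the classes of `(1, x)`, and a morphism `f` into an action extends by `t
· x ↦ β_t (f x)`; this is the universal property.

The topology rests on two facts. The quotient map is open (`IsContinuous.isOpenQuotientMap_toEnv`),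
so it remains a quotient map after multiplying by `H`, which makes the enveloping action jointly
continuous. For each fixed `t`, the map `x ↦ [t, x]` is an open embedding
(`IsContinuous.isOpenEmbedding_toEnv`), so the quotient is covered by open copies of `X`, and
everything local can be checked in one copy.

For bundles the construction is applied to the base and to the total space. The enveloping total
space must also be a disjoint union of C*-algebras, so the fibre over a class is taken to be the
fibre of `B` at a chosen representative. `envFlatten` identifies the resulting union with the
enveloping space of the total space, whose topology it receives. The choice does no harm:
`envFiberHom` identifies the fibre of `B` at any other representative with the chosen one by a
bijective, hence isometric, homomorphism. The bundle axioms, and continuity of the norm, therefore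
pass between `B` and the enveloping bundle through the charts `envMk t`. -/

noncomputable section

/-! ### The enveloping space as a quotient of `H × X`: algebra -/

namespace PartialAction

variable {H : Type*} [Group H] {X Y : Type*}

theorem act_mem (α : PartialAction H X) {t : H} {x : X} (hx : x ∈ α.dom t⁻¹) :
    α.act t x ∈ α.dom t :=
  (α.bijOn t).mapsTo hx

theorem act_inv_act (α : PartialAction H X) {t : H} {x : X} (hx : x ∈ α.dom t⁻¹) :
    α.act t⁻¹ (α.act t x) = x := by
  have h := α.act_mul t⁻¹ t x hx (by rw [inv_inv]; exact α.act_mem hx)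
  rw [← h, inv_mul_cancel, α.act_one]

/-- The equivalence relation on `H × X` whose quotient is the enveloping space. -/
def envSetoid (α : PartialAction H X) : Setoid (H × X) where
  r p q := p.2 ∈ α.dom (q.1⁻¹ * p.1)⁻¹ ∧ α.act (q.1⁻¹ * p.1) p.2 = q.2
  iseqv := by
    refine ⟨fun p => ?_, ?_, ?_⟩
    · simp [α.dom_one, α.act_one]
    · rintro ⟨s, x⟩ ⟨t, y⟩ ⟨h1, h2⟩
      dsimp only at h1 h2 ⊢
      have e : s⁻¹ * t = (t⁻¹ * s)⁻¹ := by group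
      rw [e, inv_inv, ← h2]
      exact ⟨α.act_mem h1, α.act_inv_act h1⟩
    · rintro ⟨s, x⟩ ⟨t, y⟩ ⟨r, z⟩ ⟨h1, h2⟩ ⟨h3, h4⟩
      dsimp only at h1 h2 h3 h4 ⊢
      -- Transitivity is the composition axiom for `t⁻¹ * s` followed by `r⁻¹ * t`.
      have e : r⁻¹ * s = r⁻¹ * t * (t⁻¹ * s) := by group
      rw [← h2] at h3 h4
      rw [e, ← h4]
      exact ⟨α.mul_mem _ _ _ h1 h3, α.act_mul _ _ _ h1 h3⟩

/-- The enveloping space of a partial action. -/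
def Env (α : PartialAction H X) : Type _ := Quotient α.envSetoid

/-- The class of `(t, x)` in the enveloping space. -/
def toEnv (α : PartialAction H X) (t : H) (x : X) : α.Env := Quotient.mk α.envSetoid (t, x)

theorem toEnv_eq_iff (α : PartialAction H X) {s t : H} {x y : X} :
    α.toEnv s x = α.toEnv t y ↔ x ∈ α.dom (t⁻¹ * s)⁻¹ ∧ α.act (t⁻¹ * s) x = y :=
  Quotient.eq (r := α.envSetoid)

theorem toEnv_act (α : PartialAction H X) (s : H) {t : H} {x : X} (hx : x ∈ α.dom t⁻¹) :
    α.toEnv s (α.act t x) = α.toEnv (s * t) x := by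
  refine (α.toEnv_eq_iff.mpr ?_).symm
  simpa using hx

theorem toEnv_injective (α : PartialAction H X) (t : H) : Function.Injective (α.toEnv t) := by
  intro x y h
  have h := (α.toEnv_eq_iff.mp h).2
  rwa [inv_mul_cancel, α.act_one] at h

/-- The chosen representative of a point of the enveloping space. -/
def envOut (α : PartialAction H X) (q : α.Env) : H × X := Quotient.out q

theorem toEnv_envOut (α : PartialAction H X) (q : α.Env) :
    α.toEnv (α.envOut q).1 (α.envOut q).2 = q :=
  Quotient.out_eq q

theorem env_ind (α : PartialAction H X) {P : α.Env → Prop} (h : ∀ t x, P (α.toEnv t x))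
    (q : α.Env) : P q := by
  rw [← α.toEnv_envOut q]
  exact h _ _

/-- The map on the enveloping space induced by a map on `H × X`. -/
def envLift (α : PartialAction H X) (f : H → X → Y)
    (hf : ∀ s t x, x ∈ α.dom t⁻¹ → f s (α.act t x) = f (s * t) x) : α.Env → Y :=
  Quotient.lift (fun p : H × X => f p.1 p.2) (by
    rintro ⟨s, x⟩ ⟨t, y⟩ ⟨h1, h2⟩
    dsimp only at h1 h2 ⊢
    rw [← h2, hf _ _ _ h1]
    simp)

@[simp]
theorem envLift_toEnv (α : PartialAction H X) (f : H → X → Y)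
    (hf : ∀ s t x, x ∈ α.dom t⁻¹ → f s (α.act t x) = f (s * t) x) (t : H) (x : X) :
    α.envLift f hf (α.toEnv t x) = f t x :=
  rfl

/-- A partial action given by a group action. -/
def ofGlobal (f : H → Y → Y) (h1 : ∀ y, f 1 y = y) (hm : ∀ s t y, f (s * t) y = f s (f t y)) :
    PartialAction H Y where
  dom _ := univ
  act := f
  dom_one := rfl
  bijOn t := by
    rw [bijOn_univ]
    refine Function.bijective_iff_has_inverse.mpr ⟨f t⁻¹, fun y => ?_, fun y => ?_⟩
    · rw [← hm, inv_mul_cancel, h1]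
    · rw [← hm, mul_inv_cancel, h1]
  act_one := h1
  mul_mem _ _ _ _ _ := trivial
  act_mul s t y _ _ := hm s t y

/-- The enveloping action: `s` maps the class of `(t, x)` to the class of `(s * t, x)`. -/
def env (α : PartialAction H X) : PartialAction H α.Env :=
  ofGlobal (fun s => α.envLift (fun t x => α.toEnv (s * t) x) fun t r x hx => by
      rw [α.toEnv_act _ hx, mul_assoc])
    (α.env_ind fun t x => by simp)
    (fun s r => α.env_ind fun t x => by simp [mul_assoc])

@[simp]
theorem env_act_toEnv (α : PartialAction H X) (s t : H) (x : X) :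
    α.env.act s (α.toEnv t x) = α.toEnv (s * t) x :=
  rfl

theorem env_isGlobal (α : PartialAction H X) : α.env.IsGlobal := fun _ => rfl

theorem IsGlobal.graphDom_eq_univ {β : PartialAction H Y} (hβ : β.IsGlobal) :
    β.graphDom = univ := by
  ext q
  simp [graphDom, hβ q.1⁻¹]

theorem orbit_range_toEnv_one (α : PartialAction H X) :
    α.env.orbit (range (α.toEnv 1)) = univ := by
  refine eq_univ_of_forall (α.env_ind fun t x => ?_)
  exact mem_iUnion.mpr ⟨t, α.toEnv 1 x, ⟨⟨x, rfl⟩, trivial⟩, by simp⟩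

/-! ### Topology of the enveloping space -/

section Topological

variable [TopologicalSpace X] [TopologicalSpace Y]

/-- The extension of a morphism into a global action to the enveloping space. -/
def IsMorphism.envExtend {α : PartialAction H X} {β : PartialAction H Y} {f : X → Y}
    (hf : α.IsMorphism β f) (hβ : β.IsGlobal) : α.Env → Y :=
  α.envLift (fun t x => β.act t (f x)) fun s t x hx => by
    rw [← hf.map_act t x hx, hβ.act_mul]

@[simp]
theorem IsMorphism.envExtend_toEnv {α : PartialAction H X} {β : PartialAction H Y} {f : X → Y}
    (hf : α.IsMorphism β f) (hβ : β.IsGlobal) (t : H) (x : X) :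
    hf.envExtend hβ (α.toEnv t x) = β.act t (f x) :=
  rfl

variable [TopologicalSpace H]

instance (α : PartialAction H X) : TopologicalSpace α.Env :=
  inferInstanceAs (TopologicalSpace (Quotient α.envSetoid))

theorem continuous_toEnv_uncurry (α : PartialAction H X) :
    Continuous fun p : H × X => α.toEnv p.1 p.2 :=
  continuous_quotient_mk'

theorem isOpen_env_iff (α : PartialAction H X) {W : Set α.Env} :
    IsOpen W ↔ IsOpen ((fun p : H × X => α.toEnv p.1 p.2) ⁻¹' W) :=
  isOpen_coinduced

theorem IsGlobal.continuous_act {β : PartialAction H Y} (hβ : β.IsGlobal) (hc : β.IsContinuous) :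
    Continuous fun q : H × Y => β.act q.1 q.2 := by
  have h := hc.continuousOn
  rw [hβ.graphDom_eq_univ] at h
  exact continuousOn_univ.mp h

theorem continuous_toEnv (α : PartialAction H X) (t : H) : Continuous (α.toEnv t) :=
  α.continuous_toEnv_uncurry.comp (Continuous.prodMk_right t)

theorem isMorphism_toEnv_one (α : PartialAction H X) : α.IsMorphism α.env (α.toEnv 1) :=
  ⟨α.continuous_toEnv 1, fun _ _ _ => trivial, fun t x hx => by
    rw [α.toEnv_act _ hx, env_act_toEnv, mul_one, one_mul]⟩

theorem IsMorphism.isMorphism_envExtend {α : PartialAction H X} {β : PartialAction H Y}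
    {f : X → Y} (hf : α.IsMorphism β f) (hβ : β.IsGlobal) (hc : β.IsContinuous) :
    α.env.IsMorphism β (hf.envExtend hβ) where
  continuous := by
    refine continuous_coinduced_dom.mpr ?_
    exact (hβ.continuous_act hc).comp
      (continuous_fst.prodMk (hf.continuous.comp continuous_snd))
  mapsTo t _ _ := by rw [hβ t]; trivial
  map_act s q _ := by
    induction q using α.env_ind with
    | h t x => simp [hβ.act_mul]

variable [IsTopologicalGroup H]

/-- The saturation of an open `W` is the union over `r = t⁻¹ * s` of its preimages under `(s, x) ↦
(s * r⁻¹, α_r x)`, each of which is continuous on an open set. Openness matters because, unlike a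
general quotient map, an open one stays a quotient map in products. -/
theorem IsContinuous.isOpenQuotientMap_toEnv {α : PartialAction H X} (hα : α.IsContinuous) :
    IsOpenQuotientMap fun p : H × X => α.toEnv p.1 p.2 := by
  refine ⟨α.env_ind fun t x => ⟨(t, x), rfl⟩, α.continuous_toEnv_uncurry, fun W hW => ?_⟩
  refine α.isOpen_env_iff.mpr ?_
  have : (fun p : H × X => α.toEnv p.1 p.2) ⁻¹' ((fun p : H × X => α.toEnv p.1 p.2) '' W) =
      ⋃ r : H, {p : H × X | p.2 ∈ α.dom r⁻¹} ∩ (fun p => (p.1 * r⁻¹, α.act r p.2)) ⁻¹' W := by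
    ext ⟨s, x⟩
    rw [mem_iUnion]
    constructor
    · rintro ⟨⟨t, y⟩, hW, h⟩
      obtain ⟨h1, h2⟩ := α.toEnv_eq_iff.mp h.symm
      refine ⟨t⁻¹ * s, h1, ?_⟩
      simpa [h2] using hW
    · rintro ⟨r, hr, hW⟩
      refine ⟨_, hW, ?_⟩
      exact (α.toEnv_act _ hr).trans (by rw [inv_mul_cancel_right])
  rw [this]
  refine isOpen_iUnion fun r => ?_
  have hop : IsOpen {p : H × X | p.2 ∈ α.dom r⁻¹} :=
    hα.isOpen_graphDom.preimage (f := fun p : H × X => (r, p.2)) (by fun_prop)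
  refine ContinuousOn.isOpen_inter_preimage ?_ hop hW
  refine (by fun_prop : Continuous fun p : H × X => p.1 * r⁻¹).continuousOn.prodMk ?_
  exact hα.continuousOn.comp
    (by fun_prop : Continuous fun p : H × X => (r, p.2)).continuousOn fun p hp => hp

/-- The product of `id` on `H` with the open quotient map is again a quotient map, so joint
continuity can be tested on `H × H × X`, where it is continuity of multiplication. -/
theorem IsContinuous.env {α : PartialAction H X} (hα : α.IsContinuous) : α.env.IsContinuous := by
  refine ⟨by rw [α.env_isGlobal.graphDom_eq_univ]; exact isOpen_univ, Continuous.continuousOn ?_⟩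
  have hq := (IsOpenQuotientMap.id (X := H)).prodMap hα.isOpenQuotientMap_toEnv
  refine hq.isQuotientMap.continuous_iff.mpr ?_
  exact α.continuous_toEnv_uncurry.comp
    (by fun_prop : Continuous fun p : H × H × X => (p.1 * p.2.1, p.2.2))

/-- The class of `(s, x)` lies in the image of `U` exactly when `α_{t⁻¹s}` is defined at `x` with
value in `U`. This condition is open in `(s, x)` jointly because the domain of `α` is open and the
action is jointly continuous there. -/
theorem IsContinuous.isOpenEmbedding_toEnv {α : PartialAction H X} (hα : α.IsContinuous) (t : H) :
    IsOpenEmbedding (α.toEnv t) := by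
  refine .of_continuous_injective_isOpenMap (α.continuous_toEnv t) (α.toEnv_injective t)
    fun U hU => ?_
  refine α.isOpen_env_iff.mpr ?_
  have : (fun p : H × X => α.toEnv p.1 p.2) ⁻¹' (α.toEnv t '' U) =
      (fun p : H × X => (t⁻¹ * p.1, p.2)) ⁻¹'
        (α.graphDom ∩ (fun q : H × X => α.act q.1 q.2) ⁻¹' U) := by
    ext ⟨s, x⟩
    constructor
    · rintro ⟨y, hy, h⟩
      obtain ⟨h1, h2⟩ := α.toEnv_eq_iff.mp h.symm
      exact ⟨h1, by simpa [h2] using hy⟩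
    · rintro ⟨h1, h2⟩
      exact ⟨_, h2, (α.toEnv_eq_iff.mpr ⟨h1, rfl⟩).symm⟩
  rw [this]
  exact (hα.continuousOn.isOpen_inter_preimage hα.isOpen_graphDom hU).preimage (by fun_prop)

end Topological

end PartialAction

/-! ### The enveloping bundle -/

namespace BundlePartialAction

variable {H : Type*} [Group H] [TopologicalSpace H] {X : Type*} [TopologicalSpace X]
  {B : USCStarBundle X}

/-- The endpoint is a free variable `y`, so that no fibre has to be transported along an equality of
base points. -/
theorem exists_fiberHom (α : BundlePartialAction H B) {t : H} {x y : X}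
    (hx : x ∈ α.base.dom t⁻¹) (h : α.base.act t x = y) :
    ∃ φ : B.fiber x →⋆ₙₐ[ℂ] B.fiber y, ∀ b, α.total.act t ⟨x, b⟩ = ⟨y, φ b⟩ := by
  subst h
  exact α.fiber_hom t x hx

theorem mem_total_dom (α : BundlePartialAction H B) {t : H} {b : B.Total} :
    b ∈ α.total.dom t ↔ b.proj ∈ α.base.dom t := by
  rw [← α.preimage_dom]
  rfl

/-- The fibre of the enveloping bundle: the fibre of `B` at the chosen representative. -/
def envFiber (α : BundlePartialAction H B) (q : α.base.Env) : Type _ :=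
  B.fiber (α.base.envOut q).2

instance (α : BundlePartialAction H B) (q : α.base.Env) : NonUnitalCStarAlgebra (α.envFiber q) :=
  inferInstanceAs (NonUnitalCStarAlgebra (B.fiber _))

/-- A point of the enveloping bundle as a point of the enveloping space of the total space. -/
def envFlatten (α : BundlePartialAction H B) (c : TotalSpace Unit α.envFiber) : α.total.Env :=
  α.total.toEnv (α.base.envOut c.proj).1 ⟨(α.base.envOut c.proj).2, c.snd⟩

/-- If `(s, y)` is the chosen representative of the class of `(t, x)`, then `α_{s⁻¹t}` takes `x` to
`y`, and its action on the fibre is the required homomorphism. -/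
theorem exists_envFiberHom (α : BundlePartialAction H B) (t : H) (x : X) :
    ∃ φ : B.fiber x →⋆ₙₐ[ℂ] α.envFiber (α.base.toEnv t x),
      ∀ b, α.envFlatten ⟨α.base.toEnv t x, φ b⟩ = α.total.toEnv t ⟨x, b⟩ := by
  obtain ⟨h1, h2⟩ :=
    α.base.toEnv_eq_iff.mp (α.base.toEnv_envOut (α.base.toEnv t x)).symm
  obtain ⟨φ, hφ⟩ := α.exists_fiberHom h1 h2
  exact ⟨φ, fun b => (α.total.toEnv_eq_iff.mpr ⟨α.mem_total_dom.mpr h1, hφ b⟩).symm⟩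

/-- The identification of `B_x` with the fibre of the enveloping bundle at the class of
`(t, x)`. -/
def envFiberHom (α : BundlePartialAction H B) (t : H) (x : X) :
    B.fiber x →⋆ₙₐ[ℂ] α.envFiber (α.base.toEnv t x) :=
  (α.exists_envFiberHom t x).choose

/-- The class of `(t, b)` in the total space of the enveloping bundle. -/
def envMk (α : BundlePartialAction H B) (t : H) (b : B.Total) : TotalSpace Unit α.envFiber :=
  ⟨α.base.toEnv t b.proj, α.envFiberHom t b.proj b.snd⟩

@[simp]
theorem envFlatten_envMk (α : BundlePartialAction H B) (t : H) (b : B.Total) :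
    α.envFlatten (α.envMk t b) = α.total.toEnv t b :=
  (α.exists_envFiberHom t b.proj).choose_spec b.snd

/-- The projection of the enveloping space of the total space. -/
def envProj (α : BundlePartialAction H B) : α.total.Env → α.base.Env :=
  α.total.envLift (fun t b => α.base.toEnv t b.proj) fun s t b hb => by
    rw [← α.base.toEnv_act s (α.mem_total_dom.mp hb)]
    exact congrArg _ (α.proj_isMorphism.map_act t b hb).symm

theorem envProj_envFlatten (α : BundlePartialAction H B) (c : TotalSpace Unit α.envFiber) :
    α.envProj (α.envFlatten c) = c.proj :=
  α.base.toEnv_envOut c.proj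

theorem envFlatten_bijective (α : BundlePartialAction H B) :
    Function.Bijective α.envFlatten := by
  constructor
  · rintro ⟨q, b⟩ ⟨q', b'⟩ h
    have hq := congrArg α.envProj h
    rw [envProj_envFlatten, envProj_envFlatten] at hq
    dsimp only at hq
    subst hq
    -- Both points lie over the same class, so they are flattened with the same representative, in
    -- particular the same group element.
    have h := α.total.toEnv_injective _ h
    exact congrArg (TotalSpace.mk q) ((TotalSpace.mk_inj (E := B.fiber)).mp h)
  · exact α.total.env_ind fun t b => ⟨α.envMk t b, α.envFlatten_envMk t b⟩

theorem envMk_envOut (α : BundlePartialAction H B) (c : TotalSpace Unit α.envFiber) :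
    α.envMk (α.base.envOut c.proj).1 ⟨(α.base.envOut c.proj).2, c.snd⟩ = c := by
  apply α.envFlatten_bijective.1
  rw [envFlatten_envMk]
  rfl

theorem envMk_ind (α : BundlePartialAction H B) {P : TotalSpace Unit α.envFiber → Prop}
    (h : ∀ t b, P (α.envMk t b)) (c : TotalSpace Unit α.envFiber) : P c := by
  rw [← α.envMk_envOut c]
  exact h _ _

theorem envMk_injective (α : BundlePartialAction H B) (t : H) :
    Function.Injective (α.envMk t) := by
  intro b c h
  apply α.total.toEnv_injective t
  rw [← envFlatten_envMk, h, envFlatten_envMk]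

/-- The fibre of the total space over the class of `(t, x)` consists of the classes of
`(t, b)`. -/
theorem exists_envMk (α : BundlePartialAction H B) {c : TotalSpace Unit α.envFiber} {t : H} {x : X}
    (hc : c.proj = α.base.toEnv t x) : ∃ b : B.Total, b.proj = x ∧ α.envMk t b = c := by
  induction c using α.envMk_ind with
  | h s b =>
    obtain ⟨h1, h2⟩ := α.base.toEnv_eq_iff.mp hc
    have hb := α.mem_total_dom.mpr h1
    refine ⟨α.total.act (t⁻¹ * s) b, ?_, ?_⟩
    · rw [← h2]
      exact (α.proj_isMorphism.map_act _ b hb).symm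
    · apply α.envFlatten_bijective.1
      rw [envFlatten_envMk, envFlatten_envMk, α.total.toEnv_act _ hb, mul_inv_cancel_left]

/-- Bijectivity turns `envFiberHom` into an isomorphism of C*-algebras; injectivity alone already
makes it isometric. -/
theorem envFiberHom_bijective (α : BundlePartialAction H B) (t : H) (x : X) :
    Function.Bijective (α.envFiberHom t x) := by
  constructor
  · intro b b' h
    have : α.envMk t ⟨x, b⟩ = α.envMk t ⟨x, b'⟩ := congrArg (TotalSpace.mk _) h
    exact TotalSpace.mk_inj.mp (α.envMk_injective t this)
  · intro c
    obtain ⟨⟨y, b⟩, hy, hb⟩ := α.exists_envMk (c := ⟨α.base.toEnv t x, c⟩) rfl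
    obtain rfl : y = x := hy
    exact ⟨b, TotalSpace.mk_inj.mp hb⟩

theorem norm_envFiberHom (α : BundlePartialAction H B) (t : H) {x : X} (b : B.fiber x) :
    ‖α.envFiberHom t x b‖ = ‖b‖ :=
  NonUnitalStarAlgHom.norm_map _ (α.envFiberHom_bijective t x).1 b

theorem range_envMk (α : BundlePartialAction H B) (t : H) :
    range (α.envMk t) = TotalSpace.proj ⁻¹' range (α.base.toEnv t) := by
  ext c
  constructor
  · rintro ⟨b, rfl⟩
    exact ⟨b.proj, rfl⟩
  · rintro ⟨x, hx⟩
    obtain ⟨b, -, hb⟩ := α.exists_envMk hx.symm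
    exact ⟨b, hb⟩

/-- The map of fibre products induced by `envMk`. -/
def envMkProd (α : BundlePartialAction H B) (t : H)
    (d : TotalSpace (Unit × Unit) (B.fiber ×ᵇ B.fiber)) :
    TotalSpace (Unit × Unit) (α.envFiber ×ᵇ α.envFiber) :=
  ⟨α.base.toEnv t d.proj, (α.envFiberHom t d.proj d.snd.1, α.envFiberHom t d.proj d.snd.2)⟩

theorem range_envMkProd (α : BundlePartialAction H B) (t : H) :
    range (α.envMkProd t) = TotalSpace.proj ⁻¹' range (α.base.toEnv t) := by
  ext ⟨q, c, c'⟩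
  constructor
  · rintro ⟨d, hd⟩
    exact ⟨d.proj, congrArg TotalSpace.proj hd⟩
  · rintro ⟨x, hx⟩
    obtain rfl : α.base.toEnv t x = q := hx
    obtain ⟨b, rfl⟩ := (α.envFiberHom_bijective t x).2 c
    obtain ⟨b', rfl⟩ := (α.envFiberHom_bijective t x).2 c'
    exact ⟨⟨x, b, b'⟩, rfl⟩

/-- Since `envFlatten` is a bijection, this is the quotient topology from `H × B.Total`,
transported. -/
instance (α : BundlePartialAction H B) : TopologicalSpace (TotalSpace Unit α.envFiber) :=
  TopologicalSpace.induced α.envFlatten inferInstance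

/-- The enveloping bundle is homeomorphic to the enveloping space of the total space. -/
theorem isHomeomorph_envFlatten (α : BundlePartialAction H B) : IsHomeomorph α.envFlatten :=
  isHomeomorph_iff_isEmbedding_surjective.mpr
    ⟨⟨⟨rfl⟩, α.envFlatten_bijective.1⟩, α.envFlatten_bijective.2⟩

theorem continuous_envMk_uncurry (α : BundlePartialAction H B) :
    Continuous fun p : H × B.Total => α.envMk p.1 p.2 := by
  refine continuous_induced_rng.mpr ?_
  simpa only [Function.comp_def, envFlatten_envMk] using α.total.continuous_toEnv_uncurry

variable [IsTopologicalGroup H]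

theorem isOpenQuotientMap_envMk (α : BundlePartialAction H B) :
    IsOpenQuotientMap fun p : H × B.Total => α.envMk p.1 p.2 := by
  refine ⟨α.envMk_ind fun t b => ⟨(t, b), rfl⟩, α.continuous_envMk_uncurry, ?_⟩
  refine α.isHomeomorph_envFlatten.isOpenEmbedding.isOpenMap_iff.mpr ?_
  simpa only [Function.comp_def, envFlatten_envMk] using
    α.total_continuous.isOpenQuotientMap_toEnv.isOpenMap

theorem isOpenEmbedding_envMk (α : BundlePartialAction H B) (t : H) :
    IsOpenEmbedding (α.envMk t) := by
  refine (IsOpenEmbedding.of_comp_iff (α.envMk t)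
    α.isHomeomorph_envFlatten.isOpenEmbedding).mp ?_
  simpa only [Function.comp_def, envFlatten_envMk] using
    α.total_continuous.isOpenEmbedding_toEnv t

theorem continuous_envProj (α : BundlePartialAction H B) :
    Continuous (TotalSpace.proj : TotalSpace Unit α.envFiber → α.base.Env) := by
  refine α.isOpenQuotientMap_envMk.isQuotientMap.continuous_iff.mpr ?_
  exact α.base.continuous_toEnv_uncurry.comp
    (continuous_fst.prodMk (B.continuous_proj.comp continuous_snd))

/-- The fibre product carries the topology induced from the product of total spaces, where the map
becomes `envMk t × envMk t`. -/
theorem isInducing_envMkProd (α : BundlePartialAction H B) (t : H) :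
    IsInducing (α.envMkProd t) := by
  refine ((FiberBundle.Prod.isInducing_diag Unit α.envFiber Unit α.envFiber).of_comp_iff).mp ?_
  exact ((α.isOpenEmbedding_envMk t).isInducing.prodMap
    (α.isOpenEmbedding_envMk t).isInducing).comp
      (FiberBundle.Prod.isInducing_diag Unit B.fiber Unit B.fiber)

/-- Two points of one fibre can be written with a common `t`, so the ranges of the `envMkProd t`
cover the fibre product. They are open, being preimages of open sets of the base, so continuity of
the fibrewise operations is checked in one chart at a time. -/
theorem continuous_of_comp_envMkProd (α : BundlePartialAction H B) {Y : Type*} [TopologicalSpace Y]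
    {f : TotalSpace (Unit × Unit) (α.envFiber ×ᵇ α.envFiber) → Y}
    (hf : ∀ t, Continuous (f ∘ α.envMkProd t)) : Continuous f := by
  rw [continuous_iff_continuousAt]
  intro d
  obtain ⟨t, x, hx⟩ : ∃ t x, α.base.toEnv t x = d.proj :=
    ⟨_, _, α.base.toEnv_envOut d.proj⟩
  obtain ⟨e, rfl⟩ : d ∈ range (α.envMkProd t) := by
    rw [range_envMkProd]
    exact ⟨x, hx⟩
  have hproj : Continuous (TotalSpace.proj :
      TotalSpace (Unit × Unit) (α.envFiber ×ᵇ α.envFiber) → α.base.Env) :=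
    α.continuous_envProj.comp (continuous_fst.comp
      (FiberBundle.Prod.isInducing_diag Unit α.envFiber Unit α.envFiber).continuous)
  have hmem : range (α.envMkProd t) ∈ 𝓝 (α.envMkProd t e) := by
    refine IsOpen.mem_nhds ?_ (mem_range_self e)
    rw [range_envMkProd]
    exact (α.base_continuous.isOpenEmbedding_toEnv t).isOpen_range.preimage hproj
  rw [ContinuousAt, ← (α.isInducing_envMkProd t).map_nhds_of_mem e hmem, tendsto_map'_iff]
  exact (hf t).continuousAt

/-- The enveloping bundle. -/
abbrev envBundle (α : BundlePartialAction H B) : USCStarBundle α.base.Env where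
  fiber := α.envFiber
  continuous_proj := α.continuous_envProj
  isOpenMap_proj := by
    -- Precomposed with the quotient map, the projection is `(t, b) ↦ [t, p b]`, a composite of open
    -- maps.
    refine IsOpenMap.of_comp (f := fun p : H × B.Total => α.envMk p.1 p.2)
      α.isOpenQuotientMap_envMk.continuous α.isOpenQuotientMap_envMk.surjective ?_
    exact α.base_continuous.isOpenQuotientMap_toEnv.isOpenMap.comp
      (IsOpenMap.id.prodMap B.isOpenMap_proj)
  upperSemicontinuous_norm := by
    rw [upperSemicontinuous_iff_isOpen_preimage]
    intro r
    refine α.isOpenQuotientMap_envMk.isQuotientMap.isOpen_preimage.mp ?_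
    have h := (upperSemicontinuous_iff_isOpen_preimage.mp B.upperSemicontinuous_norm r).preimage
      (continuous_snd (X := H))
    convert h using 1
    ext ⟨t, b⟩
    simp [envMk, norm_envFiberHom]
  continuous_add := by
    refine α.continuous_of_comp_envMkProd fun t => ?_
    refine ((α.isOpenEmbedding_envMk t).continuous.comp B.continuous_add).congr fun d => ?_
    exact congrArg (TotalSpace.mk _) (map_add (α.envFiberHom t d.proj) _ _)
  continuous_mul := by
    refine α.continuous_of_comp_envMkProd fun t => ?_
    refine ((α.isOpenEmbedding_envMk t).continuous.comp B.continuous_mul).congr fun d => ?_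
    exact congrArg (TotalSpace.mk _) (map_mul (α.envFiberHom t d.proj) _ _)
  continuous_smul c := by
    refine α.isOpenQuotientMap_envMk.isQuotientMap.continuous_iff.mpr ?_
    refine (α.continuous_envMk_uncurry.comp
      (continuous_id.prodMap (B.continuous_smul c))).congr fun p => ?_
    exact congrArg (TotalSpace.mk _) (map_smul (α.envFiberHom p.1 p.2.proj) c p.2.snd)
  continuous_star := by
    refine α.isOpenQuotientMap_envMk.isQuotientMap.continuous_iff.mpr ?_
    refine (α.continuous_envMk_uncurry.comp
      (continuous_id.prodMap B.continuous_star)).congr fun p => ?_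
    exact congrArg (TotalSpace.mk _) (map_star (α.envFiberHom p.1 p.2.proj) p.2.snd)
  tendsto_zero := by
    refine α.base.env_ind fun t x => ?_
    have h0 : (⟨α.base.toEnv t x, 0⟩ : TotalSpace Unit α.envFiber) = α.envMk t ⟨x, 0⟩ := by
      simp [envMk]
    -- Near the class of `(t, x)` everything happens in the chart `t`, where the condition is the
    -- one for `B` at `x` because norms are preserved.
    rw [h0, ← (α.isOpenEmbedding_envMk t).map_nhds_eq,
      ← (α.base_continuous.isOpenEmbedding_toEnv t).map_nhds_eq]
    intro W hW
    obtain ⟨U, ⟨U', hU', hU⟩, V, ⟨V', hV', hV⟩, hUV⟩ := mem_inf_iff.mp (B.tendsto_zero x hW)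
    refine mem_inf_iff_superset.mpr ⟨_, preimage_mem_comap (image_mem_map hU'),
      _, preimage_mem_comap hV', ?_⟩
    rintro c ⟨⟨y, hy, hyc⟩, hc⟩
    obtain ⟨⟨z, b⟩, hz, rfl⟩ := α.exists_envMk hyc.symm
    obtain rfl : z = y := hz
    have hb : (⟨z, b⟩ : B.Total) ∈ α.envMk t ⁻¹' W := by
      rw [hUV]
      refine ⟨hU hy, hV ?_⟩
      have : ‖α.envFiberHom t z b‖ ∈ V' := hc
      rwa [norm_envFiberHom] at this
    exact hb

/-- The class of `(t, b)` has norm `‖b‖`: restrict to `t = 1` for one direction, descend from `H ×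
B.Total` for the other. -/
theorem envBundle_isContinuous_iff (α : BundlePartialAction H B) :
    α.envBundle.IsContinuous ↔ B.IsContinuous := by
  constructor
  · intro h
    refine (Continuous.comp h (α.isOpenEmbedding_envMk 1).continuous).congr fun b => ?_
    exact α.norm_envFiberHom 1 b.snd
  · intro h
    refine α.isOpenQuotientMap_envMk.isQuotientMap.continuous_iff.mpr ?_
    refine (Continuous.comp h continuous_snd).congr fun p => ?_
    exact (α.norm_envFiberHom p.1 p.2.snd).symm

end BundlePartialAction

/-! ### The enveloping action on the bundle and its universal property -/

namespace BundlePartialAction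

variable {H : Type*} [Group H] [TopologicalSpace H] {X Y : Type*} [TopologicalSpace X]
  [TopologicalSpace Y] {B : USCStarBundle X} {C : USCStarBundle Y}

theorem IsGlobal.total {β : BundlePartialAction H C} (hβ : β.IsGlobal) : β.total.IsGlobal :=
  hβ

theorem Morphism.map_total_act {α : BundlePartialAction H B} {β : BundlePartialAction H C}
    (hα : α.IsGlobal) (f : Morphism α β) (t : H) (b : B.Total) :
    f.total (α.total.act t b) = β.total.act t (f.total b) :=
  (f.total_isMorphism.map_act t b (by rw [hα t⁻¹]; trivial)).symm

theorem Morphism.map_base_act {α : BundlePartialAction H B} {β : BundlePartialAction H C}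
    (hα : α.IsGlobal) (f : Morphism α β) (t : H) (x : X) :
    f.base (α.base.act t x) = β.base.act t (f.base x) :=
  (f.base_isMorphism.map_act t x (by rw [hα.base t⁻¹]; trivial)).symm

variable [IsTopologicalGroup H]

/-- The action on the total space of the enveloping bundle. -/
def envAct (α : BundlePartialAction H B) (s : H) (c : α.envBundle.Total) : α.envBundle.Total :=
  α.envMk (s * (α.base.envOut c.proj).1) ⟨(α.base.envOut c.proj).2, c.snd⟩

@[simp]
theorem envAct_envMk (α : BundlePartialAction H B) (s t : H) (b : B.Total) :
    α.envAct s (α.envMk t b) = α.envMk (s * t) b := by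
  apply α.envFlatten_bijective.1
  have h : ∀ c : α.envBundle.Total,
      α.envFlatten (α.envAct s c) = α.total.env.act s (α.envFlatten c) :=
    fun c => α.envFlatten_envMk _ _
  rw [h, envFlatten_envMk, envFlatten_envMk, PartialAction.env_act_toEnv]

/-- The enveloping action of a partial action on a bundle. -/
def env (α : BundlePartialAction H B) : BundlePartialAction H α.envBundle where
  total := PartialAction.ofGlobal α.envAct (α.envMk_ind fun t b => by rw [envAct_envMk, one_mul])
    (fun s r => α.envMk_ind fun t b => by simp only [envAct_envMk, mul_assoc])
  base := α.base.env
  total_continuous := by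
    refine ⟨?_, Continuous.continuousOn ?_⟩
    · rw [PartialAction.IsGlobal.graphDom_eq_univ fun _ => rfl]
      exact isOpen_univ
    have hq := (IsOpenQuotientMap.id (X := H)).prodMap α.isOpenQuotientMap_envMk
    refine hq.isQuotientMap.continuous_iff.mpr ?_
    refine (α.continuous_envMk_uncurry.comp
      (by fun_prop : Continuous fun p : H × H × B.Total => (p.1 * p.2.1, p.2.2))).congr fun p => ?_
    exact (α.envAct_envMk p.1 p.2.1 p.2.2).symm
  base_continuous := α.base_continuous.env
  preimage_dom _ := rfl
  proj_isMorphism := by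
    refine ⟨α.continuous_envProj, fun _ _ _ => trivial, fun s c _ => ?_⟩
    induction c using α.envMk_ind with
    | h t b => exact congrArg TotalSpace.proj (α.envAct_envMk s t b).symm
  fiber_hom s q _ := by
    -- With `(t, x)` the representative of `q`, the fibre over `q` is the fibre of `B` at `x` by
    -- definition, and `s` maps it by `envFiberHom (s * t) x`. The equality puts the target fibre in
    -- that form.
    have h : α.base.toEnv (s * (α.base.envOut q).1) (α.base.envOut q).2 = α.base.env.act s q := by
      conv_rhs => rw [← α.base.toEnv_envOut q]
      rfl
    rw [← h]
    exact ⟨α.envFiberHom _ _, fun c => rfl⟩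

theorem env_isGlobal (α : BundlePartialAction H B) : α.env.IsGlobal := fun _ => rfl

@[simp]
theorem env_total_act_envMk (α : BundlePartialAction H B) (s t : H) (b : B.Total) :
    α.env.total.act s (α.envMk t b) = α.envMk (s * t) b :=
  α.envAct_envMk s t b

/-- The inclusion of a partial action on a bundle into its enveloping action. -/
def envIncl (α : BundlePartialAction H B) : Morphism α α.env where
  total := α.envMk 1
  base := α.base.toEnv 1
  total_isMorphism := by
    refine ⟨(α.isOpenEmbedding_envMk 1).continuous, fun _ _ _ => trivial, fun t b hb => ?_⟩
    rw [env_total_act_envMk]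
    apply α.envFlatten_bijective.1
    rw [envFlatten_envMk, envFlatten_envMk, α.total.toEnv_act _ hb, mul_one, one_mul]
  base_isMorphism := α.base.isMorphism_toEnv_one
  fiberwise x := ⟨α.envFiberHom 1 x, fun _ => rfl⟩

/-- The extension of a morphism into a global action to the enveloping action. -/
def Morphism.envExtend {α : BundlePartialAction H B} {β : BundlePartialAction H C}
    (hβ : β.IsGlobal) (ψ : Morphism α β) : Morphism α.env β where
  total := ψ.total_isMorphism.envExtend hβ.total ∘ α.envFlatten
  base := ψ.base_isMorphism.envExtend hβ.base
  total_isMorphism := by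
    have h := ψ.total_isMorphism.isMorphism_envExtend hβ.total β.total_continuous
    refine ⟨h.continuous.comp α.isHomeomorph_envFlatten.continuous,
      fun t _ _ => by rw [hβ t]; trivial, fun s c _ => ?_⟩
    induction c using α.envMk_ind with
    | h t b =>
      rw [env_total_act_envMk]
      simp [hβ.total.act_mul]
  base_isMorphism := ψ.base_isMorphism.isMorphism_envExtend hβ.base β.base_continuous
  fiberwise q := by
    -- On the fibre over `q`, with representative `(t, x)`, the extension is `ψ` on the fibre at `x`
    -- followed by `β_t`, a composite of two homomorphisms.
    have hq : ψ.base_isMorphism.envExtend hβ.base q =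
        β.base.act (α.base.envOut q).1 (ψ.base (α.base.envOut q).2) := by
      conv_lhs => rw [← α.base.toEnv_envOut q]
      rfl
    rw [hq]
    obtain ⟨f, hf⟩ := ψ.fiberwise (α.base.envOut q).2
    obtain ⟨g, hg⟩ := β.fiber_hom (α.base.envOut q).1 (ψ.base (α.base.envOut q).2)
      (by rw [hβ.base _]; trivial)
    refine ⟨g.comp f, fun c => ?_⟩
    have h : β.total.act (α.base.envOut q).1 (ψ.total ⟨(α.base.envOut q).2, c⟩) =
        ⟨_, g (f c)⟩ := by
      rw [← hg]
      exact congrArg _ (hf c)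
    exact h

theorem Morphism.envExtend_comp_envIncl {α : BundlePartialAction H B}
    {β : BundlePartialAction H C} (hβ : β.IsGlobal) (ψ : Morphism α β) :
    (ψ.envExtend hβ).comp α.envIncl = ψ := by
  ext1
  · funext b
    change ψ.total_isMorphism.envExtend hβ.total (α.envFlatten (α.envMk 1 b)) = _
    rw [envFlatten_envMk, PartialAction.IsMorphism.envExtend_toEnv, β.total.act_one]
  · funext x
    exact β.base.act_one _

/-- Every point of the envelope is a translate `t · [1, b]`, and morphisms between global actions
commute with translation. -/
theorem Morphism.env_ext {α : BundlePartialAction H B} {β : BundlePartialAction H C}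
    {f g : Morphism α.env β} (h : f.comp α.envIncl = g.comp α.envIncl) : f = g := by
  ext1
  · funext c
    induction c using α.envMk_ind with
    | h t b =>
      have hb : f.total (α.envMk 1 b) = g.total (α.envMk 1 b) :=
        congrFun (congrArg Morphism.total h) b
      have e : α.envMk t b = α.env.total.act t (α.envMk 1 b) := by
        rw [env_total_act_envMk, mul_one]
      rw [e, f.map_total_act α.env_isGlobal, g.map_total_act α.env_isGlobal, hb]
  · funext q
    induction q using α.base.env_ind with
    | h t x =>
      have hx : f.base (α.base.toEnv 1 x) = g.base (α.base.toEnv 1 x) :=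
        congrFun (congrArg Morphism.base h) x
      have e : α.base.toEnv t x = α.env.base.act t (α.base.toEnv 1 x) := by
        rw [show α.env.base = α.base.env from rfl, PartialAction.env_act_toEnv, mul_one]
      rw [e, f.map_base_act α.env_isGlobal, g.map_base_act α.env_isGlobal, hx]

theorem envIncl_isUniversal (α : BundlePartialAction H B) : IsUniversal.{v, w} α.envIncl :=
  fun _ _ _ _ hβ ψ => ⟨ψ.envExtend hβ, ψ.envExtend_comp_envIncl hβ,
    fun _ h => Morphism.env_ext (h.trans (ψ.envExtend_comp_envIncl hβ).symm)⟩

end BundlePartialAction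

/-! ### Restriction to the open image, and uniqueness of the envelope -/

namespace PartialAction

variable {H : Type*} [Group H] {X Y Z : Type*}

/-- A morphism into a global action whose values lie in a subspace is a morphism into the
restriction to the subspace. -/
theorem IsMorphism.restrict_codomain [TopologicalSpace X] [TopologicalSpace Y]
    [TopologicalSpace Z] {α : PartialAction H X} {γ : PartialAction H Y} {j : Z → Y} {k : X → Z}
    (hγ : γ.IsGlobal) (hj : IsEmbedding j) (h : α.IsMorphism γ (j ∘ k)) :
    α.IsMorphism (γ.restrict hγ j hj.injective) k := by
  have hm : ∀ t, MapsTo k (α.dom t) ((γ.restrict hγ j hj.injective).dom t) := by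
    intro t x hx
    obtain ⟨y, hy, rfl⟩ := (α.bijOn t).surjOn hx
    exact ⟨k y, h.map_act t y hy⟩
  refine ⟨hj.continuous_iff.mpr h.continuous, hm, fun t x hx => hj.injective ?_⟩
  rw [map_restrict_act _ _ _ _ (hm _ hx)]
  exact h.map_act t x hx

/-- A lift, through an embedding of `α` into a global action, of the inclusion of a restriction
of that action is a morphism. -/
theorem IsMorphism.of_comp_eq_restrict [TopologicalSpace X] [TopologicalSpace Y]
    [TopologicalSpace Z] {α : PartialAction H X} {γ : PartialAction H Y} {j : Z → Y} {i : X → Y}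
    {g : Z → X} (hγ : γ.IsGlobal) (hj : IsEmbedding j) (hi : IsEmbedding i)
    (h : α.IsMorphism γ i) (hdom : ∀ t x, γ.act t (i x) ∈ range i → x ∈ α.dom t⁻¹)
    (hg : ∀ z, i (g z) = j z) : (γ.restrict hγ j hj.injective).IsMorphism α g := by
  have hm : ∀ t, MapsTo g ((γ.restrict hγ j hj.injective).dom t) (α.dom t) := by
    rintro t z ⟨w, hw⟩
    rw [← inv_inv t]
    refine hdom _ _ ⟨g w, ?_⟩
    rw [hg, hg, ← hw, hγ.act_inv_act]
  refine ⟨hi.continuous_iff.mpr ?_, hm, fun t z hz => hi.injective ?_⟩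
  · exact hj.continuous.congr fun z => (hg z).symm
  · rw [← h.map_act t _ (hm _ hz), hg, hg, map_restrict_act _ _ _ _ hz]

end PartialAction

namespace BundlePartialAction

variable {H : Type*} [Group H] [TopologicalSpace H] {X Y : Type*} [TopologicalSpace X]
  [TopologicalSpace Y] {B : USCStarBundle X} {C : USCStarBundle Y}

theorem Morphism.exists_fiberHom {α : BundlePartialAction H B} {γ : BundlePartialAction H C}
    (ι : Morphism α γ) {x : X} {y : Y} (h : ι.base x = y) :
    ∃ φ : B.fiber x →⋆ₙₐ[ℂ] C.fiber y, ∀ b, ι.total ⟨x, b⟩ = ⟨y, φ b⟩ := by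
  subst h
  exact ι.fiberwise x

/-- A morphism into a global action, as a morphism into the restriction to an open set containing
the image of the base. -/
def Morphism.restrictCodomain {α : BundlePartialAction H B} {γ : BundlePartialAction H C}
    (hγ : γ.IsGlobal) (ι : Morphism α γ) {U : Set Y} (hU : IsOpen U) (h : ∀ x, ι.base x ∈ U) :
    Morphism α (γ.restrict hγ U hU) where
  total b := ⟨⟨(ι.total b).proj, by
    rw [show (ι.total b).proj = _ from ι.proj_total b]
    exact h _⟩, (ι.total b).snd⟩
  base x := ⟨ι.base x, h x⟩
  total_isMorphism := ι.total_isMorphism.restrict_codomain (j := C.restrictIncl U) hγ.total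
    (C.isOpenEmbedding_restrictIncl hU).isEmbedding
  base_isMorphism := ι.base_isMorphism.restrict_codomain (j := ((↑) : U → Y)) hγ.base .subtypeVal
  fiberwise x := by
    obtain ⟨f, hf⟩ := ι.fiberwise x
    exact ⟨f, fun b => C.restrictIncl_injective U (hf b)⟩

theorem Morphism.restrictIncl_comp_restrictCodomain {α : BundlePartialAction H B}
    {γ : BundlePartialAction H C} (hγ : γ.IsGlobal) (ι : Morphism α γ) {U : Set Y} (hU : IsOpen U)
    (h : ∀ x, ι.base x ∈ U) :
    (γ.restrictIncl hγ U hU).comp (ι.restrictCodomain hγ hU h) = ι :=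
  rfl

/-- A morphism that embeds a partial action as the part of a global action over an open set is an
isomorphism onto the restriction to that set. -/
theorem Morphism.restrictCodomain_isIso {α : BundlePartialAction H B}
    {γ : BundlePartialAction H C} (hγ : γ.IsGlobal) (ι : Morphism α γ)
    (hU : IsOpen (range ι.base)) (hbase : IsEmbedding ι.base) (htotal : IsEmbedding ι.total)
    (hrange : C.proj ⁻¹' range ι.base ⊆ range ι.total)
    (hdom : ∀ t x, γ.base.act t (ι.base x) ∈ range ι.base → x ∈ α.base.dom t⁻¹) :
    (ι.restrictCodomain hγ hU mem_range_self).IsIso := by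
  have hmem : ∀ c, C.restrictIncl (range ι.base) c ∈ range ι.total := fun c =>
    hrange (by rw [← C.range_restrictIncl]; exact mem_range_self c)
  choose g hg using fun u : range ι.base => u.2
  choose G hG using hmem
  -- The domains in the total space are preimages of those in the base, so the hypothesis on the
  -- base suffices.
  have hdom' : ∀ t b, γ.total.act t (ι.total b) ∈ range ι.total → b ∈ α.total.dom t⁻¹ := by
    rintro t b ⟨b', hb⟩
    refine α.mem_total_dom.mpr (hdom t b.proj ⟨b'.proj, ?_⟩)
    rw [← ι.proj_total, ← ι.proj_total, hb]
    exact (γ.proj_isMorphism.map_act t _ (by rw [hγ.total t⁻¹]; trivial)).symm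
  let ψ : Morphism (γ.restrict hγ (range ι.base) hU) α :=
    { total := G
      base := g
      total_isMorphism := ι.total_isMorphism.of_comp_eq_restrict hγ.total
        (C.isOpenEmbedding_restrictIncl hU).isEmbedding htotal hdom' hG
      base_isMorphism := ι.base_isMorphism.of_comp_eq_restrict hγ.base .subtypeVal hbase hdom hg
      fiberwise u := by
        obtain ⟨φ, hφ⟩ := ι.exists_fiberHom (hg u)
        -- Invertibility on fibres comes from the global hypotheses: `ι.total` is injective and
        -- reaches everything over the image, and injectivity of `ι.base` puts each preimage in the
        -- fibre at `g u`.
        have hbij : Function.Bijective φ := by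
          constructor
          · intro b b' h
            have h' : ι.total ⟨g u, b⟩ = ι.total ⟨g u, b'⟩ := by rw [hφ, hφ, h]
            exact TotalSpace.mk_inj.mp (htotal.injective h')
          · intro c
            obtain ⟨⟨x, b⟩, hb⟩ := hrange (show (⟨u.1, c⟩ : C.Total) ∈ _ from u.2)
            have hx : ι.base x = u.1 := by
              have := ι.proj_total ⟨x, b⟩
              rw [hb] at this
              exact this.symm
            obtain rfl : x = g u := hbase.injective (hx.trans (hg u).symm)
            exact ⟨b, TotalSpace.mk_inj.mp ((hφ b).symm.trans hb)⟩
        let e := StarAlgEquiv.ofBijective φ hbij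
        refine ⟨(e.symm : C.fiber u.1 →⋆ₙₐ[ℂ] B.fiber (g u)), fun c => htotal.injective ?_⟩
        rw [hG]
        refine Eq.trans ?_ (hφ _).symm
        exact congrArg (TotalSpace.mk u.1) (e.apply_symm_apply c).symm }
  refine ⟨ψ, ?_, ?_⟩
  · ext1
    · funext b
      exact htotal.injective (hG _)
    · funext x
      exact hbase.injective (hg _)
  · ext1
    · funext c
      exact C.restrictIncl_injective _ (hG c)
    · funext u
      exact Subtype.ext (hg u)

/-- Each universal morphism factors through the other; both composites of the two factorisations fix
a universal morphism, hence are identities. The factorisation is unique even among morphisms not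
assumed invertible. Both envelopes live in the same universes, so that each may serve as a target
for the other. -/
theorem IsUniversal.existsUnique_isIso {Xe : Type x} [TopologicalSpace Xe]
    {Be : USCStarBundle.{x, b} Xe} {Ye : Type x} [TopologicalSpace Ye]
    {Ce : USCStarBundle.{x, b} Ye} {α : BundlePartialAction H B}
    {β : BundlePartialAction H Be} {γ : BundlePartialAction H Ce} {ι : Morphism α β}
    {κ : Morphism α γ} (hβ : β.IsGlobal) (hγ : γ.IsGlobal) (hι : IsUniversal.{x, b} ι)
    (hκ : IsUniversal.{x, b} κ) : ∃! φ : Morphism β γ, φ.IsIso ∧ φ.comp ι = κ := by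
  obtain ⟨φ, hφ, hφ'⟩ := hι _ _ γ hγ κ
  obtain ⟨ψ, hψ, -⟩ := hκ _ _ β hβ ι
  refine ⟨φ, ⟨⟨ψ, ?_, ?_⟩, hφ⟩, fun φ' h => hφ' φ' h.2⟩
  · refine (hι _ _ β hβ ι).unique ?_ rfl
    change ψ.comp (φ.comp ι) = ι
    rw [hφ, hψ]
  · refine (hκ _ _ γ hγ κ).unique ?_ rfl
    change φ.comp (ψ.comp κ) = κ
    rw [hψ, hφ]

variable [IsTopologicalGroup H]

theorem isOpen_range_envIncl (α : BundlePartialAction H B) : IsOpen (range α.envIncl.base) :=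
  (α.base_continuous.isOpenEmbedding_toEnv 1).isOpen_range

theorem envIncl_restrictCodomain_isIso (α : BundlePartialAction H B) :
    (α.envIncl.restrictCodomain α.env_isGlobal α.isOpen_range_envIncl mem_range_self).IsIso := by
  refine α.envIncl.restrictCodomain_isIso α.env_isGlobal α.isOpen_range_envIncl
    (α.base_continuous.isOpenEmbedding_toEnv 1).isEmbedding
    (α.isOpenEmbedding_envMk 1).isEmbedding (α.range_envMk 1).ge ?_
  -- An equality `[t, x] = [1, y]` says, by the defining relation, that `α_t` is defined at `x`: the
  -- copy of `X` contains no orbit relation beyond those of `α`.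
  rintro t x ⟨y, hy⟩
  have h : α.base.toEnv (t * 1) x = α.base.toEnv 1 y := hy.symm
  simpa using (α.base.toEnv_eq_iff.mp h).1

end BundlePartialAction

end

theorem mainTheorem5 {H : Type h} [Group H] [TopologicalSpace H]
    [IsTopologicalGroup H] [LocallyCompactSpace H] [T2Space H]
    {X : Type x} [TopologicalSpace X] (B : USCStarBundle.{x, b} X)
    (α : BundlePartialAction H B) :
    ∃ (Xe : Type (max h x)) (_ : TopologicalSpace Xe) (Be : USCStarBundle.{max h x, b} Xe)
      (αe : BundlePartialAction H Be) (hαe : αe.IsGlobal) (ι : BundlePartialAction.Morphism α αe),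
      -- the universal property
      BundlePartialAction.IsUniversal.{v, w} ι ∧
      -- uniqueness
      (∀ (Y : Type (max h x)) (_ : TopologicalSpace Y) (C : USCStarBundle.{max h x, b} Y)
        (γ : BundlePartialAction H C), γ.IsGlobal → ∀ κ : BundlePartialAction.Morphism α γ,
        BundlePartialAction.IsUniversal.{max h x, b} κ → ∃! φ : BundlePartialAction.Morphism αe γ, φ.IsIso ∧ φ.comp ι = κ) ∧
      -- `X` is open in `Xe`, and `α` is the restriction of `αe` to it
      (∃ hU : IsOpen (range ι.base), ∃ φ : BundlePartialAction.Morphism α (αe.restrict hαe (range ι.base) hU),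
        φ.IsIso ∧ (αe.restrictIncl hαe (range ι.base) hU).comp φ = ι) ∧
      -- `Xe` is the orbit of `X`
      αe.base.orbit (range ι.base) = univ ∧
      (Be.IsContinuous ↔ B.IsContinuous) := by
  refine ⟨α.base.Env, inferInstance, α.envBundle, α.env, α.env_isGlobal, α.envIncl,
    α.envIncl_isUniversal, ?_, ?_, α.base.orbit_range_toEnv_one, α.envBundle_isContinuous_iff⟩
  · intro Y _ C γ hγ κ hκ
    exact α.envIncl_isUniversal.existsUnique_isIso α.env_isGlobal hγ hκ
  · exact ⟨α.isOpen_range_envIncl, _, α.envIncl_restrictCodomain_isIso,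
      α.envIncl.restrictIncl_comp_restrictCodomain α.env_isGlobal _ _⟩
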